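/- **Setting.** Consider $K$ arms and a true state $\theta\in\Theta\subseteq\mathbb R^d$ (possibly $\Theta=\mathbb R^d$). In state $\vartheta\in\Theta$ the rewards of arm $i$ have law $P_{\vartheta,i}$, a member of a canonical one-parameter exponential family on $\mathbb R$ attached to arm $i$, with natural parameter in the interior of the natural parameter space. Every state $\vartheta$ has a unique answer $\mathcal I(\vartheta)$. Assume $\mathrm{Alt}(\theta)=\{\vartheta\in\Theta:\mathcal I(\vartheta)\ne\mathcal I(\theta)\}=\bigcup_{x\in\mathcal X}\mathrm{Alt}_x(\theta)$ with $\mathcal X$ finite and each $\mathrm{Alt}_x(\theta)$ nonempty and convex. For $p\in\mathbb R^K_{\ge0}$ put $$D(p,x)=\inf_{\vartheta\in\mathrm{Alt}_x(\theta)}\sum_{i=1}^K p_i\,\mathrm{KL}(P_{\theta,i}\,\|\,P_{\vartheta,i}),\qquad F(p,\mu)=\sum_{x\in\mathcal X}\mu_xD(p,x).$$ Let $\Delta_K$, $\Delta_{|\mathcal X|}$ be the probability simplices. Assume that there is $M_p<\infty$ with $\|\nabla_pD(p,x)\|_\infty\le M_p$ for all $x\in\mathcal X$ and all $p\in\Delta_K$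 at which $D(\cdot,x)$ is differentiable, and that $F$ is twice continuously differentiable at every point of $\mathrm{int}(\Delta_K)\times\Delta_{|\mathcal X|}$ (relative interior). Differentiability at boundary points is understood relative to $\mathbb R^K_{\ge 0}$ (respectively $\mathbb R^K_{\ge0}\times\mathbb R^{\mathcal X}$ for $F$). Let $\mathcal D_F\subseteq\Delta_K\times\Delta_{|\mathcal X|}$ be the set of points at which $F$ is differentiable. For $(p,\mu)\in\Delta_K\times\Delta_{|\mathcal X|}$ let $$\partial_p^\circ F(p,\mu)=\mathrm{conv}\Bigl\{\lim_{n\to\infty}\nabla_pF(p^n,\mu^n):(p^n,\mu^n)\to(p,\mu),\ (p^n,\mu^n)\in\mathcal D_F\Bigr\},$$ $$\mathrm{LMO}_p(p,\mu)=\mathrm{conv}\Bigl\{q\in\Delta_K:\exists f\in\partial_p^\circ F(p,\mu),\ q\in\operatorname*{argmax}_{q'\in\Delta_K}q'^\top f\Bigr\},\qquad \mathrm{LMO}_\mu(p,\mu)=\operatorname*{argmin}_{\nu\in\Delta_{|\mathcal X|}}\nu^\top\nabla_\mu F(p,\mu),$$ $$G(p,\mu)=\bigl(\mathrm{LMO}_p(p,\mu)-p,\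 \mathrm{LMO}_\mu(p,\mu)-\mu\bigr),$$ and for $\varepsilon\ge0$, with $d(y,S)=\inf_{a\in S}\|y-a\|_1$, $$G^\varepsilon(z)=\Bigl\{y\in\mathbb R^{K+|\mathcal X|}:\exists z'\in\Delta_K\times\Delta_{|\mathcal X|},\ \|z-z'\|_1+d\bigl(y,G(z')\bigr)\le\varepsilon\Bigr\},\qquad z\in\Delta_K\times\Delta_{|\mathcal X|}.$$ For $z_0\in\Delta_K\times\Delta_{|\mathcal X|}$ let $\mathcal T^{\varepsilon,T}(z_0)$ be the set of absolutely continuous $z:[0,T]\to\Delta_K\times\Delta_{|\mathcal X|}$ with $z(0)=z_0$ and $\dot z(t)\in G^\varepsilon(z(t))$ for almost every $t\in[0,T]$. The graph of a correspondence $H$ on $\Delta_K\times\Delta_{|\mathcal X|}$ is $\{(z,y):y\in H(z)\}$. **Proposition (Graph Stability).** (i) For every $\varepsilon>0$, $\mathrm{graph}(G^\varepsilon)\subseteq\mathrm{graph}(G)+\varepsilon\mathbb B$: for every $(z,y)\in\mathrm{graph}(G^\varepsilon)$ there is $(z',y')\in\mathrm{graph}(G)$ with $\|z-z'\|_1+\|y-y'\|_1\le\varepsilon$.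 (ii) For all $\delta>0$ and $T>0$ there is $\varepsilon>0$ such that $\mathrm{graph}(\mathcal T^{\varepsilon,T})\subseteq\mathrm{graph}(\mathcal T^{0,T})+\delta\mathbb B$: for every $z_0\in\Delta_K\times\Delta_{|\mathcal X|}$ and every $z\in\mathcal T^{\varepsilon,T}(z_0)$ there are $z_0'\in\Delta_K\times\Delta_{|\mathcal X|}$ and $z'\in\mathcal T^{0,T}(z_0')$ with $\|z_0-z_0'\|_1+\sup_{t\in[0,T]}\|z(t)-z'(t)\|_1\le\delta$. -/

import Mathlib

open MeasureTheory Set Filter Topology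

noncomputable section

/-- Data of a canonical (natural) one-parameter exponential family on `ℝ`: a σ-finite reference
measure that is not concentrated on one point (so that the members of the family are in bijection
with their means). -/
structure NatExpFamily where
  base : Measure ℝ
  sigmaFinite : SigmaFinite base
  nondegenerate : ∀ c : ℝ, ¬ ∀ᵐ y ∂base, y = c

/-- The (open) natural parameter space. -/
def NatExpFamily.naturalSpace (E : NatExpFamily) : Set ℝ :=
  interior (ProbabilityTheory.integrableExpSet id E.base)

/-- The member with natural parameter `η`, of density `exp (η y - A(η))` with respect to the
reference measure. -/
def NatExpFamily.member (E : NatExpFamily) (η : ℝ) : Measure ℝ :=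
  E.base.tilted (fun y => η * y)

/-- A `K`-armed bandit model with states of nature in a subset of `ℝ^d` (possibly all of `ℝ^d`), and
a question whose unique answer at the state `ϑ` is `answer ϑ`. The reward law of arm `i` in the
state `ϑ` is the member with natural parameter `natParam ϑ i` of the exponential family of the arm
(specifying the natural parameter is the same as specifying the mean). -/
structure BanditModel (K d : ℕ) (Ans : Type*) where
  fam : Fin K → NatExpFamily
  states : Set (EuclideanSpace ℝ (Fin d))
  natParam : EuclideanSpace ℝ (Fin d) → Fin K → ℝ
  natParam_mem : ∀ ϑ ∈ states, ∀ i, natParam ϑ i ∈ (fam i).naturalSpace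
  answer : EuclideanSpace ℝ (Fin d) → Ans

namespace BanditModel

variable {K d : ℕ} {Ans : Type*}

/-- The law of the rewards of arm `i` in the state `ϑ`. -/
def law (B : BanditModel K d Ans) (ϑ : EuclideanSpace ℝ (Fin d)) (i : Fin K) : Measure ℝ :=
  (B.fam i).member (B.natParam ϑ i)

/-- `Γ(p, ϑ) = ∑ i, p i * KL(P_{θ,i} ‖ P_{ϑ,i})`, where `θ` is the true state. -/
def information (B : BanditModel K d Ans) (θ : EuclideanSpace ℝ (Fin d)) (p : Fin K → ℝ)
    (ϑ : EuclideanSpace ℝ (Fin d)) : ℝ :=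
  ∑ i, p i * (InformationTheory.klDiv (B.law θ i) (B.law ϑ i)).toReal

/-- The alternative set: the states with an answer different from that of `θ`. -/
def altSet (B : BanditModel K d Ans) (θ : EuclideanSpace ℝ (Fin d)) :
    Set (EuclideanSpace ℝ (Fin d)) :=
  {ϑ | ϑ ∈ B.states ∧ B.answer ϑ ≠ B.answer θ}

/-- The alternative set at `θ` is the union of finitely many (nonempty) convex sets `alt x`. -/
structure AltDecomposition (B : BanditModel K d Ans) (θ : EuclideanSpace ℝ (Fin d))
    (X : Type*) [Fintype X] where
  alt : X → Set (EuclideanSpace ℝ (Fin d))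
  alt_nonempty : ∀ x, (alt x).Nonempty
  alt_convex : ∀ x, Convex ℝ (alt x)
  altSet_eq : B.altSet θ = ⋃ x, alt x

/-- `D(p, x) = inf_{ϑ ∈ Alt_x(θ)} Γ(p, ϑ)` (meaningful for `p` in the nonnegative orthant). -/
def scenarioPayoff {X : Type*} [Fintype X] (B : BanditModel K d Ans)
    (θ : EuclideanSpace ℝ (Fin d)) (A : B.AltDecomposition θ X) (p : Fin K → ℝ) (x : X) : ℝ :=
  sInf (B.information θ p '' A.alt x)

end BanditModel

namespace SelfPlay

variable {K : ℕ} {X : Type*} [Fintype X] [DecidableEq X]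

/-- The nonnegative orthant of `ℝ^K`. -/
def orthant (K : ℕ) : Set (Fin K → ℝ) := {p | ∀ i, 0 ≤ p i}

/-- `Δ_K × Δ_X`. -/
def stateSpace (K : ℕ) (X : Type*) [Fintype X] : Set ((Fin K → ℝ) × (X → ℝ)) :=
  stdSimplex ℝ (Fin K) ×ˢ stdSimplex ℝ X

/-- The mixed payoff `F(p, μ) = ∑ x, μ x * D(p, x)`. -/
def payoff (D : (Fin K → ℝ) → X → ℝ) (z : (Fin K → ℝ) × (X → ℝ)) : ℝ :=
  ∑ x, z.2 x * D z.1 x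

/-- The gradients of `D(·, x)` at those points of the simplex at which `D(·, x)` is differentiable
(as a function on the nonnegative orthant, which is where it is defined) are bounded in the
sup norm, uniformly in the points and in `x`. -/
def BoundedGradients (D : (Fin K → ℝ) → X → ℝ) : Prop :=
  ∃ M : ℝ, ∀ x : X, ∀ p ∈ stdSimplex ℝ (Fin K),
    DifferentiableWithinAt ℝ (fun p' => D p' x) (orthant K) p →
      ∀ i, |fderivWithin ℝ (fun p' => D p' x) (orthant K) p (Pi.single i 1)| ≤ M

/-- `F` is twice continuously differentiable at the points of `int Δ_K × Δ_X`, with the relative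
interior of the simplex `Δ_K`. -/
def SmoothInside (D : (Fin K → ℝ) → X → ℝ) : Prop :=
  ∀ z ∈ stateSpace K X, (∀ i, 0 < z.1 i) → ContDiffAt ℝ 2 (payoff D) z

/-- The set of the points of `Δ_K × Δ_X` at which `F` is differentiable, as a function on the
product of the nonnegative orthant of `ℝ^K` with `ℝ^X`. -/
def diffSet (D : (Fin K → ℝ) → X → ℝ) : Set ((Fin K → ℝ) × (X → ℝ)) :=
  {z | z ∈ stateSpace K X ∧ DifferentiableWithinAt ℝ (payoff D) (orthant K ×ˢ univ) z}

/-- `∇_p F(p, μ)`. -/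
def gradP (D : (Fin K → ℝ) → X → ℝ) (z : (Fin K → ℝ) × (X → ℝ)) : Fin K → ℝ :=
  fun i => fderivWithin ℝ (payoff D) (orthant K ×ˢ univ) z (Pi.single i 1, 0)

/-- `∇_μ F(p, μ)`. -/
def gradMu (D : (Fin K → ℝ) → X → ℝ) (z : (Fin K → ℝ) × (X → ℝ)) : X → ℝ :=
  fun x => fderiv ℝ (fun ν : X → ℝ => payoff D (z.1, ν)) z.2 (Pi.single x 1)

/-- The Clarke generalized gradient of `F` in `p`: the convex hull of the limits of the gradients
`∇_p F(p^n, μ^n)` along the sequences of points of differentiability that tend to `(p, μ)`. -/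
def clarkeP (D : (Fin K → ℝ) → X → ℝ) (z : (Fin K → ℝ) × (X → ℝ)) : Set (Fin K → ℝ) :=
  convexHull ℝ {f | ∃ u : ℕ → (Fin K → ℝ) × (X → ℝ), (∀ n, u n ∈ diffSet D) ∧
    Tendsto u atTop (𝓝 z) ∧ Tendsto (fun n => gradP D (u n)) atTop (𝓝 f)}

/-- The linear oracle of the maximizer. -/
def lmoP (D : (Fin K → ℝ) → X → ℝ) (z : (Fin K → ℝ) × (X → ℝ)) : Set (Fin K → ℝ) :=
  convexHull ℝ {q | q ∈ stdSimplex ℝ (Fin K) ∧ ∃ f ∈ clarkeP D z,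
    ∀ q' ∈ stdSimplex ℝ (Fin K), q' ⬝ᵥ f ≤ q ⬝ᵥ f}

/-- The linear oracle of the minimizer. -/
def lmoMu (D : (Fin K → ℝ) → X → ℝ) (z : (Fin K → ℝ) × (X → ℝ)) : Set (X → ℝ) :=
  {ν | ν ∈ stdSimplex ℝ X ∧ ∀ ν' ∈ stdSimplex ℝ X, ν ⬝ᵥ gradMu D z ≤ ν' ⬝ᵥ gradMu D z}

/-- The drift `G(p, μ) = (LMO_p(p, μ) - p, LMO_μ(p, μ) - μ)`. -/
def drift (D : (Fin K → ℝ) → X → ℝ) (z : (Fin K → ℝ) × (X → ℝ)) :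
    Set ((Fin K → ℝ) × (X → ℝ)) :=
  {y | ∃ q ∈ lmoP D z, ∃ ν ∈ lmoMu D z, y = (q - z.1, ν - z.2)}

/-- The `ℓ¹` norm on `ℝ^K × ℝ^X = ℝ^{K+|X|}`. -/
def l1 (v : (Fin K → ℝ) × (X → ℝ)) : ℝ := ∑ i, |v.1 i| + ∑ x, |v.2 x|

/-- The `ℓ¹` distance from a point to a set (`∞` if the set is empty). -/
def l1Dist (y : (Fin K → ℝ) × (X → ℝ)) (S : Set ((Fin K → ℝ) × (X → ℝ))) : ENNReal :=
  ⨅ a ∈ S, ENNReal.ofReal (l1 (y - a))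

/-- The `ε`-perturbed drift `G^ε` (for `ε ≥ 0`). -/
def perturbedDrift (D : (Fin K → ℝ) → X → ℝ) (ε : ℝ) (z : (Fin K → ℝ) × (X → ℝ)) :
    Set ((Fin K → ℝ) × (X → ℝ)) :=
  {y | ∃ z' ∈ stateSpace K X,
    ENNReal.ofReal (l1 (z - z')) + l1Dist y (drift D z') ≤ ENNReal.ofReal ε}

/-- The graph of a correspondence defined on `Δ_K × Δ_X`. -/
def graph {Y : Type*} (H : (Fin K → ℝ) × (X → ℝ) → Set Y) : Set (((Fin K → ℝ) × (X → ℝ)) × Y) :=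
  {w | w.1 ∈ stateSpace K X ∧ w.2 ∈ H w.1}

/-- `𝒯^{ε,T}(z₀)`: the absolutely continuous paths in `Δ_K × Δ_X` on `[0, T]` that start at `z₀` and
solve the `ε`-perturbed inclusion (the values of `z` outside `[0, T]` are irrelevant, and absolute
continuity does not depend on the choice of the norm). -/
def solutions (D : (Fin K → ℝ) → X → ℝ) (ε T : ℝ) (z₀ : (Fin K → ℝ) × (X → ℝ)) :
    Set (ℝ → (Fin K → ℝ) × (X → ℝ)) :=
  {z | z 0 = z₀ ∧ (∀ t ∈ Icc 0 T, z t ∈ stateSpace K X) ∧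
    AbsolutelyContinuousOnInterval z 0 T ∧
    ∀ᵐ t ∂(volume.restrict (Icc 0 T)), ∃ y ∈ perturbedDrift D ε (z t), HasDerivAt z y t}

end SelfPlay

end

/-! Both parts follow from one fact: the graph of `drift` is compact and its fibres are convex
(`isCompact_graph_drift`, `convex_drift`). For (i), compact fibres make the distance in
`perturbedDrift` attained, so nothing is lost in `ε`.

Compactness rests on a Lipschitz bound. `D(·, x)` is an infimum of linear forms that are nonnegative
on the orthant, hence superadditive and positively homogeneous. Its gradient at an interior point is
therefore a supergradient, and the gradient bound becomes a Lipschitz bound on the whole orthant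
(`exists_lipschitz_scenarioPayoff`). So `∇_p F` is bounded, the closure of its graph is compact, and
fibrewise convex hulls and argmax keep graphs compact.

For (ii), suppose closeness fails along `ε_n → 0`. The offending paths are equi-Lipschitz, so
Arzelà–Ascoli yields a uniform limit. Mean slopes on short intervals lie in a closed convex
neighbourhood of a single value of `drift`; letting `n → ∞` and then shrinking the interval puts the
derivative of the limit in `drift` (`deriv_mem_drift_of_tendsto`). The limit is thus an unperturbed
solution close to the paths, a contradiction. -/

/-! ### Convex hulls, one-sided slopes and mean slopes in normed spaces. -/

/-- The fibrewise convex hull of a compact relation with values in a finite-dimensional space is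
compact. -/
theorem IsCompact.fiberwise_convexHull {E F : Type*} [TopologicalSpace E] [T2Space E]
    [NormedAddCommGroup F] [NormedSpace ℝ F] [FiniteDimensional ℝ F] {Γ : Set (E × F)}
    (hΓ : IsCompact Γ) :
    IsCompact {w : E × F | w.2 ∈ convexHull ℝ {f | (w.1, f) ∈ Γ}} := by
  classical
  let S : (n : ℕ) → Set (E × (Fin n → ℝ) × (Fin n → F)) := fun n =>
    {a | a.2.1 ∈ stdSimplex ℝ (Fin n) ∧ ∀ i, (a.1, a.2.2 i) ∈ Γ}
  let Φ : (n : ℕ) → E × (Fin n → ℝ) × (Fin n → F) → E × F := fun n a =>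
    (a.1, ∑ i, a.2.1 i • a.2.2 i)
  have hS : ∀ n, IsCompact (S n) := by
    intro n
    have hK : IsCompact ((Prod.fst '' Γ) ×ˢ ((stdSimplex ℝ (Fin n)) ×ˢ
        (Set.pi univ fun _ : Fin n => Prod.snd '' Γ))) :=
      (hΓ.image continuous_fst).prod ((isCompact_stdSimplex ℝ (Fin n)).prod
        (isCompact_univ_pi fun _ => hΓ.image continuous_snd))
    refine hK.of_isClosed_subset ?_ ?_
    · refine IsClosed.inter ((isClosed_stdSimplex ℝ (Fin n)).preimage (by fun_prop)) ?_
      change IsClosed {a : E × (Fin n → ℝ) × (Fin n → F) | ∀ i, (a.1, a.2.2 i) ∈ Γ}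
      rw [ofPred_forall]
      exact isClosed_iInter fun i => hΓ.isClosed.preimage
        (f := fun a : E × (Fin n → ℝ) × (Fin n → F) => (a.1, a.2.2 i)) (by fun_prop)
    · rintro ⟨x, w, f⟩ ⟨hw, hf⟩
      -- An index is needed to place `x` in the projection of `Γ`; for `n = 0` the simplex is empty.
      have hn : Nonempty (Fin n) := by
        by_contra h
        rw [not_nonempty_iff] at h
        have := hw.2
        simp at this
      obtain ⟨i⟩ := hn
      exact ⟨⟨_, hf i, rfl⟩, hw, fun j _ => ⟨_, hf j, rfl⟩⟩
  have hΦ : ∀ n, Continuous (Φ n) := by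
    intro n
    fun_prop
  -- Carathéodory: at most `finrank + 1` points suffice, so finitely many compact images cover the
  -- hull.
  have key : {w : E × F | w.2 ∈ convexHull ℝ {f | (w.1, f) ∈ Γ}} =
      ⋃ n ∈ Finset.range (Module.finrank ℝ F + 2), Φ n '' S n := by
    ext ⟨x, y⟩
    simp only [mem_ofPred_eq, mem_iUnion, Finset.mem_range, exists_prop]
    constructor
    · intro h
      obtain ⟨ι, _, z, w, hz, hai, hw, hw1, hy⟩ := eq_pos_convex_span_of_mem_convexHull h
      let e := Fintype.equivFin ι
      refine ⟨Fintype.card ι, ?_, ⟨x, fun i => w (e.symm i), fun i => z (e.symm i)⟩,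
        ⟨⟨fun i => (hw _).le, ?_⟩, fun i => hz ⟨_, rfl⟩⟩, ?_⟩
      · have h1 := hai.card_le_finrank_succ
        have h2 := (vectorSpan ℝ (range z)).finrank_le
        omega
      · rw [← hw1]; exact e.symm.sum_comp w
      · refine Prod.ext rfl ?_
        rw [← hy]; exact e.symm.sum_comp fun i => w i • z i
    · rintro ⟨n, -, ⟨x', w, f⟩, ⟨hw, hf⟩, h⟩
      obtain ⟨rfl, rfl⟩ := Prod.mk.inj h
      exact (convex_convexHull ℝ _).sum_mem (fun i _ => hw.1 i) hw.2
        (fun i _ => subset_convexHull ℝ _ (hf i))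
  rw [key]
  exact (Finset.range _).isCompact_biUnion fun n _ => (hS n).image (hΦ n)

/-- Even at a boundary point of `S`, the derivative is determined in directions whose ray stays in
`S`; this evaluates `fderivWithin` on the orthant. -/
theorem HasFDerivWithinAt.tendsto_slope_ray {E : Type*} [NormedAddCommGroup E] [NormedSpace ℝ E]
    {f : E → ℝ} {g : E →L[ℝ] ℝ} {S : Set E} {p v : E} (h : HasFDerivWithinAt f g S p)
    (hv : ∀ t : ℝ, 0 < t → p + t • v ∈ S) :
    Tendsto (fun t : ℝ => t⁻¹ * (f (p + t • v) - f p)) (𝓝[>] 0) (𝓝 (g v)) := by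
  have hl : HasDerivWithinAt (fun t : ℝ => p + t • v) v (Ioi 0) 0 := by
    simpa using (((hasDerivAt_id (0 : ℝ)).smul_const v).const_add p).hasDerivWithinAt
  have h' : HasFDerivWithinAt f g S (p + (0 : ℝ) • v) := by simpa using h
  have := (h'.comp_hasDerivWithinAt (0 : ℝ) hl (fun t ht => hv t ht))
  rw [hasDerivWithinAt_iff_tendsto_slope' (by simp)] at this
  refine this.congr fun t => ?_
  simp [slope_def_field, div_eq_inv_mul]

/-- The mean slope of an absolutely continuous path lies in every closed convex set that contains
almost all of its velocities. -/
theorem AbsolutelyContinuousOnInterval.slope_mem_of_ae_hasDerivAt {E : Type*}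
    [NormedAddCommGroup E] [NormedSpace ℝ E] {z : ℝ → E} {a b : ℝ} {C : Set E} (hab : a < b)
    (hz : AbsolutelyContinuousOnInterval z a b) (hC : Convex ℝ C) (hCc : IsClosed C)
    (hd : ∀ᵐ t, t ∈ Ioc a b → ∃ y ∈ C, HasDerivAt z y t) :
    (b - a)⁻¹ • (z b - z a) ∈ C := by
  by_contra hn
  -- A separating functional reduces the claim to a real-valued path, where the fundamental theorem
  -- of calculus contradicts `hfu`.
  obtain ⟨f, u, hfu, hfC⟩ := geometric_hahn_banach_point_closed hC hCc hn
  have hf : AbsolutelyContinuousOnInterval (fun t => f (z t)) a b := by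
    refine squeeze_zero (fun t => by positivity) (fun t => ?_)
      (by simpa using Tendsto.const_mul ‖f‖ hz)
    rw [Finset.mul_sum]
    gcongr
    exact f.lipschitz.dist_le_mul _ _
  have hint := hf.integral_deriv_eq_sub
  have hle : ∫ _ in a..b, u ≤ ∫ t in a..b, deriv (fun t => f (z t)) t := by
    refine intervalIntegral.integral_mono_ae_restrict hab.le (by simp) hf.intervalIntegrable_deriv ?_
    rw [← restrict_Ioc_eq_restrict_Icc, EventuallyLE, ae_restrict_iff' measurableSet_Ioc]
    filter_upwards [hd] with t ht hmem
    obtain ⟨y, hy, hyd⟩ := ht hmem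
    have hfy : deriv (fun t => f (z t)) t = f y := (f.hasFDerivAt.comp_hasDerivAt t hyd).deriv
    exact hfy ▸ (hfC y hy).le
  rw [hint, intervalIntegral.integral_const, smul_eq_mul, ← map_sub] at hle
  rw [map_smul, smul_eq_mul, inv_mul_lt_iff₀ (by linarith)] at hfu
  linarith

/-! ### Lipschitz continuity of `D(·, x)` on the orthant. -/

namespace BanditModel

variable {K d : ℕ} {Ans : Type*} {X : Type*} [Fintype X]
  (B : BanditModel K d Ans) (θ : EuclideanSpace ℝ (Fin d))

theorem information_nonneg {p : Fin K → ℝ} (hp : p ∈ SelfPlay.orthant K)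
    (ϑ : EuclideanSpace ℝ (Fin d)) : 0 ≤ B.information θ p ϑ :=
  Finset.sum_nonneg fun i _ => mul_nonneg (hp i) ENNReal.toReal_nonneg

theorem information_add (p q : Fin K → ℝ) (ϑ : EuclideanSpace ℝ (Fin d)) :
    B.information θ (p + q) ϑ = B.information θ p ϑ + B.information θ q ϑ := by
  simp [information, add_mul, Finset.sum_add_distrib]

theorem information_smul (c : ℝ) (p : Fin K → ℝ) (ϑ : EuclideanSpace ℝ (Fin d)) :
    B.information θ (c • p) ϑ = c * B.information θ p ϑ := by
  simp [information, Finset.mul_sum, mul_assoc]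

variable {B θ} (A : B.AltDecomposition θ X)

/-- The orthant matters: `sInf` is `0` on sets unbounded below, and there `0` is a lower bound. -/
theorem scenarioPayoff_le {p : Fin K → ℝ} (hp : p ∈ SelfPlay.orthant K) {x : X}
    {ϑ : EuclideanSpace ℝ (Fin d)} (hϑ : ϑ ∈ A.alt x) :
    B.scenarioPayoff θ A p x ≤ B.information θ p ϑ :=
  csInf_le ⟨0, by rintro _ ⟨ϑ, -, rfl⟩; exact B.information_nonneg θ hp ϑ⟩ ⟨ϑ, hϑ, rfl⟩

theorem le_scenarioPayoff {p : Fin K → ℝ} {x : X} {c : ℝ}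
    (h : ∀ ϑ ∈ A.alt x, c ≤ B.information θ p ϑ) : c ≤ B.scenarioPayoff θ A p x :=
  le_csInf ((A.alt_nonempty x).image _) (by rintro _ ⟨ϑ, hϑ, rfl⟩; exact h ϑ hϑ)

theorem scenarioPayoff_smul {c : ℝ} (hc : 0 < c) {p : Fin K → ℝ} (hp : p ∈ SelfPlay.orthant K)
    (x : X) : B.scenarioPayoff θ A (c • p) x = c * B.scenarioPayoff θ A p x := by
  have hcp : c • p ∈ SelfPlay.orthant K := fun i => mul_nonneg hc.le (hp i)
  refine le_antisymm ?_ (le_scenarioPayoff A fun ϑ hϑ => ?_)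
  · rw [← div_le_iff₀' hc]
    refine le_scenarioPayoff A fun ϑ hϑ => ?_
    rw [div_le_iff₀' hc, ← information_smul]
    exact scenarioPayoff_le A hcp hϑ
  · rw [information_smul]
    exact mul_le_mul_of_nonneg_left (scenarioPayoff_le A hp hϑ) hc.le

theorem scenarioPayoff_add_le {p q : Fin K → ℝ} (hp : p ∈ SelfPlay.orthant K)
    (hq : q ∈ SelfPlay.orthant K) (x : X) :
    B.scenarioPayoff θ A p x + B.scenarioPayoff θ A q x ≤ B.scenarioPayoff θ A (p + q) x :=
  le_scenarioPayoff A fun ϑ hϑ => by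
    rw [information_add]
    exact add_le_add (scenarioPayoff_le A hp hϑ) (scenarioPayoff_le A hq hϑ)

/-- `D(·, x)` is `F` with `μ` frozen at the vertex `x` of the simplex. -/
theorem differentiableAt_scenarioPayoff [DecidableEq X]
    (hsmooth : SelfPlay.SmoothInside (B.scenarioPayoff θ A)) {p : Fin K → ℝ}
    (hp : p ∈ stdSimplex ℝ (Fin K)) (hpos : ∀ i, 0 < p i) (x : X) :
    DifferentiableAt ℝ (fun p' => B.scenarioPayoff θ A p' x) p := by
  have hd := (hsmooth (p, Pi.single x 1) ⟨hp, single_mem_stdSimplex ℝ x⟩ hpos).differentiableAt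
    (by norm_num)
  have := hd.comp (f := fun p' : Fin K → ℝ => (p', (Pi.single x 1 : X → ℝ))) p (by fun_prop)
  refine this.congr_of_eventuallyEq (Eventually.of_forall fun p' => ?_)
  simp [SelfPlay.payoff, Pi.single_apply]

/-- At a point of the relative interior of the simplex, a linear functional with coefficients bounded
by `M` agrees with the superlinear function `D(·, x)` and dominates it elsewhere. -/
theorem exists_supergradient [DecidableEq X]
    (hsmooth : SelfPlay.SmoothInside (B.scenarioPayoff θ A)) {M : ℝ}
    (hM : ∀ x : X, ∀ p ∈ stdSimplex ℝ (Fin K),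
      DifferentiableWithinAt ℝ (fun p' => B.scenarioPayoff θ A p' x) (SelfPlay.orthant K) p →
      ∀ i, |fderivWithin ℝ (fun p' => B.scenarioPayoff θ A p' x) (SelfPlay.orthant K) p
        (Pi.single i 1)| ≤ M)
    {p : Fin K → ℝ} (hp : p ∈ stdSimplex ℝ (Fin K)) (hpos : ∀ i, 0 < p i) (x : X) :
    ∃ g : (Fin K → ℝ) →L[ℝ] ℝ, (∀ i, |g (Pi.single i 1)| ≤ M) ∧
      (∀ q ∈ SelfPlay.orthant K, B.scenarioPayoff θ A q x ≤ g q) ∧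
      g p = B.scenarioPayoff θ A p x := by
  have hd := (differentiableAt_scenarioPayoff A hsmooth hp hpos x).differentiableWithinAt
    (s := SelfPlay.orthant K)
  have hpo : p ∈ SelfPlay.orthant K := hp.1
  have hray : ∀ q ∈ SelfPlay.orthant K, ∀ t : ℝ, 0 < t → p + t • q ∈ SelfPlay.orthant K :=
    fun q hq t ht i => add_nonneg (hpo i) (mul_nonneg ht.le (hq i))
  refine ⟨_, hM x p hp hd, fun q hq => ?_, ?_⟩
  -- Superadditivity and homogeneity bound every slope in the direction `q` below by `D(q, x)`.
  · refine ge_of_tendsto (hd.hasFDerivWithinAt.tendsto_slope_ray (hray q hq)) ?_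
    filter_upwards [self_mem_nhdsWithin] with t (ht : 0 < t)
    have h1 := scenarioPayoff_add_le A hpo (q := t • q) (fun i => mul_nonneg ht.le (hq i)) x
    rw [scenarioPayoff_smul A ht hq] at h1
    rw [le_inv_mul_iff₀ ht]
    linarith
  -- Euler's identity: slopes along the ray through `p` are constantly `D(p, x)`.
  · refine tendsto_nhds_unique (hd.hasFDerivWithinAt.tendsto_slope_ray (hray p hpo)) ?_
    refine tendsto_const_nhds.congr' ?_
    filter_upwards [self_mem_nhdsWithin] with t (ht : 0 < t)
    have : p + t • p = (1 + t) • p := by rw [add_smul, one_smul]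
    rw [this, scenarioPayoff_smul A (by linarith) hpo]
    field_simp
    ring

/-- The supergradient at the normalization of `q`, where the gradient bound applies, also touches at
`q` by homogeneity. -/
theorem sub_scenarioPayoff_le_of_pos [DecidableEq X]
    (hsmooth : SelfPlay.SmoothInside (B.scenarioPayoff θ A)) {M : ℝ}
    (hM : ∀ x : X, ∀ p ∈ stdSimplex ℝ (Fin K),
      DifferentiableWithinAt ℝ (fun p' => B.scenarioPayoff θ A p' x) (SelfPlay.orthant K) p →
      ∀ i, |fderivWithin ℝ (fun p' => B.scenarioPayoff θ A p' x) (SelfPlay.orthant K) p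
        (Pi.single i 1)| ≤ M)
    {p q : Fin K → ℝ} (hp : p ∈ SelfPlay.orthant K) (hq : ∀ i, 0 < q i) (x : X) :
    B.scenarioPayoff θ A p x - B.scenarioPayoff θ A q x ≤ M * ∑ i, |p i - q i| := by
  obtain hK | hK := isEmpty_or_nonempty (Fin K)
  · simp [Subsingleton.elim p q]
  have hs : 0 < ∑ i, q i := Finset.sum_pos (fun i _ => hq i) Finset.univ_nonempty
  set s := ∑ i, q i
  have hr : ∀ i, 0 < (s⁻¹ • q) i := fun i => mul_pos (inv_pos.2 hs) (hq i)
  have hr1 : s⁻¹ • q ∈ stdSimplex ℝ (Fin K) :=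
    ⟨fun i => (hr i).le, by simp [← Finset.mul_sum, s, hs.ne']⟩
  obtain ⟨g, hg, hle, heq⟩ := exists_supergradient A hsmooth hM hr1 hr x
  have hgq : B.scenarioPayoff θ A q x = g q := by
    have : q = s • (s⁻¹ • q) := by rw [smul_smul, mul_inv_cancel₀ hs.ne', one_smul]
    rw [this, scenarioPayoff_smul A hs hr1.1, map_smul, heq, smul_eq_mul]
  have hsum : g (p - q) = ∑ i, (p i - q i) * g (Pi.single i 1) := by
    conv_lhs => rw [pi_eq_sum_univ' (p - q)]
    simp [map_sum]
  calc _ ≤ g (p - q) := by rw [hgq, map_sub]; linarith [hle p hp]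
    _ ≤ M * ∑ i, |p i - q i| := by
      rw [hsum, Finset.mul_sum]
      refine Finset.sum_le_sum fun i _ => (le_abs_self _).trans ?_
      rw [abs_mul, mul_comm]
      exact mul_le_mul_of_nonneg_right (hg i) (abs_nonneg _)

/-- For `q` on the boundary, move to `q + t • 1` and let `t → 0` in each linear form separately,
before taking the infimum over `ϑ`. -/
theorem sub_scenarioPayoff_le [DecidableEq X]
    (hsmooth : SelfPlay.SmoothInside (B.scenarioPayoff θ A)) {M : ℝ}
    (hM : ∀ x : X, ∀ p ∈ stdSimplex ℝ (Fin K),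
      DifferentiableWithinAt ℝ (fun p' => B.scenarioPayoff θ A p' x) (SelfPlay.orthant K) p →
      ∀ i, |fderivWithin ℝ (fun p' => B.scenarioPayoff θ A p' x) (SelfPlay.orthant K) p
        (Pi.single i 1)| ≤ M)
    {p q : Fin K → ℝ} (hp : p ∈ SelfPlay.orthant K) (hq : q ∈ SelfPlay.orthant K) (x : X) :
    B.scenarioPayoff θ A p x - B.scenarioPayoff θ A q x ≤ M * ∑ i, |p i - q i| := by
  suffices h : B.scenarioPayoff θ A p x - M * ∑ i, |p i - q i| ≤ B.scenarioPayoff θ A q x by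
    linarith
  refine le_scenarioPayoff A fun ϑ hϑ => ?_
  have hlim : Tendsto (fun t : ℝ => B.information θ q ϑ + t * B.information θ 1 ϑ +
      M * ∑ i, |p i - (q + t • (1 : Fin K → ℝ)) i|) (𝓝[>] 0)
      (𝓝 (B.information θ q ϑ + M * ∑ i, |p i - q i|)) := by
    have hc : Continuous (fun t : ℝ => B.information θ q ϑ + t * B.information θ 1 ϑ +
      M * ∑ i, |p i - (q + t • (1 : Fin K → ℝ)) i|) := by
      simp only [Pi.add_apply, Pi.smul_apply]
      fun_prop
    simpa using (hc.tendsto 0).mono_left nhdsWithin_le_nhds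
  have : B.scenarioPayoff θ A p x ≤ B.information θ q ϑ + M * ∑ i, |p i - q i| := by
    refine ge_of_tendsto hlim ?_
    filter_upwards [self_mem_nhdsWithin] with t (ht : 0 < t)
    have hpos : ∀ i, 0 < (q + t • (1 : Fin K → ℝ)) i := fun i => by
      simpa using add_pos_of_nonneg_of_pos (hq i) ht
    have h1 := sub_scenarioPayoff_le_of_pos A hsmooth hM hp hpos x
    have h2 := scenarioPayoff_le A (p := q + t • (1 : Fin K → ℝ)) (fun i => (hpos i).le) hϑ
    rw [information_add, information_smul] at h2
    linarith
  linarith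

/-- `D(·, x)` is Lipschitz on the nonnegative orthant for the `ℓ¹` norm, uniformly in `x`. -/
theorem exists_lipschitz_scenarioPayoff [DecidableEq X]
    (hgrad : SelfPlay.BoundedGradients (B.scenarioPayoff θ A))
    (hsmooth : SelfPlay.SmoothInside (B.scenarioPayoff θ A)) :
    ∃ M : ℝ, 0 ≤ M ∧ ∀ x, ∀ p ∈ SelfPlay.orthant K, ∀ q ∈ SelfPlay.orthant K,
      |B.scenarioPayoff θ A p x - B.scenarioPayoff θ A q x| ≤ M * ∑ i, |p i - q i| := by
  obtain ⟨M, hM⟩ := hgrad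
  have hM' := fun x p hp hd i => (hM x p hp hd i).trans (le_max_left M 0)
  refine ⟨max M 0, le_max_right _ _, fun x p hp q hq => abs_sub_le_iff.2
    ⟨sub_scenarioPayoff_le A hsmooth hM' hp hq x, ?_⟩⟩
  simpa only [abs_sub_comm] using
    sub_scenarioPayoff_le A hsmooth hM' hq hp x

end BanditModel

/-! ### Compactness of the graph of the drift. -/

namespace SelfPlay

variable {K : ℕ} {X : Type*} {D : (Fin K → ℝ) → X → ℝ} {M : ℝ}

/-- `D(·, x)` is `M`-Lipschitz on the nonnegative orthant for the `ℓ¹` norm, for every `x`. -/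
def LipschitzOnOrthant (D : (Fin K → ℝ) → X → ℝ) (M : ℝ) : Prop :=
  ∀ x, ∀ p ∈ orthant K, ∀ q ∈ orthant K, |D p x - D q x| ≤ M * ∑ i, |p i - q i|

theorem LipschitzOnOrthant.continuousOn (hD : LipschitzOnOrthant D M) (x : X) :
    ContinuousOn (fun p => D p x) (orthant K) := by
  intro p hp
  rw [ContinuousWithinAt, tendsto_iff_dist_tendsto_zero]
  have hc : Continuous fun q : Fin K → ℝ => M * ∑ i, |q i - p i| := by fun_prop
  refine squeeze_zero' (Eventually.of_forall fun _ => dist_nonneg) ?_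
    (by simpa using (hc.tendsto p).mono_left nhdsWithin_le_nhds)
  filter_upwards [self_mem_nhdsWithin] with q hq using hD x q hq p hp

variable [Fintype X]

theorem isCompact_stateSpace : IsCompact (stateSpace K X) :=
  (isCompact_stdSimplex ℝ (Fin K)).prod (isCompact_stdSimplex ℝ X)

theorem l1_nonneg (v : (Fin K → ℝ) × (X → ℝ)) : 0 ≤ l1 v := by
  unfold l1; positivity

theorem continuous_l1 : Continuous (l1 : (Fin K → ℝ) × (X → ℝ) → ℝ) := by
  unfold l1; fun_prop

theorem norm_le_l1 (v : (Fin K → ℝ) × (X → ℝ)) : ‖v‖ ≤ l1 v := by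
  have h1 : 0 ≤ ∑ i, |v.1 i| := by positivity
  have h2 : 0 ≤ ∑ x, |v.2 x| := by positivity
  refine max_le ?_ ?_
  · exact (pi_norm_le_iff_of_nonneg (l1_nonneg v)).2 fun i =>
      (Finset.single_le_sum (f := fun i => |v.1 i|) (fun j _ => abs_nonneg _)
        (Finset.mem_univ i)).trans (le_add_of_nonneg_right h2)
  · exact (pi_norm_le_iff_of_nonneg (l1_nonneg v)).2 fun i =>
      (Finset.single_le_sum (f := fun i => |v.2 i|) (fun j _ => abs_nonneg _)
        (Finset.mem_univ i)).trans (le_add_of_nonneg_left h1)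

theorem l1_le_norm (v : (Fin K → ℝ) × (X → ℝ)) :
    l1 v ≤ (K + Fintype.card X) * ‖v‖ := by
  have h1 : ∑ i, |v.1 i| ≤ ∑ _i : Fin K, ‖v‖ :=
    Finset.sum_le_sum fun i _ => (norm_le_pi_norm v.1 i).trans (norm_fst_le v)
  have h2 : ∑ i, |v.2 i| ≤ ∑ _i : X, ‖v‖ :=
    Finset.sum_le_sum fun i _ => (norm_le_pi_norm v.2 i).trans (norm_snd_le v)
  simp only [Finset.sum_const, Finset.card_univ, Fintype.card_fin, nsmul_eq_mul] at h1 h2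
  unfold l1
  linarith

theorem gradMu_apply [DecidableEq X] (D : (Fin K → ℝ) → X → ℝ) (z : (Fin K → ℝ) × (X → ℝ))
    (x : X) : gradMu D z x = D z.1 x := by
  let L : (X → ℝ) →L[ℝ] ℝ := ∑ x, D z.1 x • ContinuousLinearMap.proj x
  have hL : (fun ν : X → ℝ => payoff D (z.1, ν)) = L := by
    ext ν
    simp [payoff, L, mul_comm]
  rw [gradMu, hL, L.fderiv]
  simp [L, Pi.single_apply]

/-- `F` can be differentiable where some `D(·, x)` with `μ x = 0` is not, so the bound goes through
the Lipschitz constant, along rays `+e_i` that stay in the orthant. -/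
theorem abs_gradP_le (hD : LipschitzOnOrthant D M)
    {z : (Fin K → ℝ) × (X → ℝ)} (hz : z ∈ diffSet D) (i : Fin K) : |gradP D z i| ≤ M := by
  obtain ⟨⟨hz1, hz2⟩, hd⟩ := hz
  have hmem : ∀ t : ℝ, 0 < t → z.1 + t • (Pi.single i 1 : Fin K → ℝ) ∈ orthant K := fun t ht j =>
    add_nonneg (hz1.1 j) (mul_nonneg ht.le (by
      rw [Pi.single_apply]; split_ifs <;> norm_num))
  have hray : ∀ t : ℝ, 0 < t → z + t • ((Pi.single i 1, 0) : (Fin K → ℝ) × (X → ℝ)) ∈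
      orthant K ×ˢ univ := fun t ht => ⟨hmem t ht, mem_univ _⟩
  refine le_of_tendsto (hd.hasFDerivWithinAt.tendsto_slope_ray hray).abs ?_
  filter_upwards [self_mem_nhdsWithin] with t (ht : 0 < t)
  rw [abs_mul, abs_of_pos (inv_pos.2 ht), inv_mul_le_iff₀ ht]
  simp only [payoff, Prod.fst_add, Prod.snd_add, Prod.smul_fst, Prod.smul_snd, smul_zero, add_zero]
  rw [← Finset.sum_sub_distrib]
  calc |∑ x, (z.2 x * D (z.1 + t • (Pi.single i 1 : Fin K → ℝ)) x - z.2 x * D z.1 x)|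
      ≤ ∑ x, z.2 x * (t * M) := by
        refine (Finset.abs_sum_le_sum_abs _ _).trans (Finset.sum_le_sum fun x _ => ?_)
        rw [← mul_sub, abs_mul, abs_of_nonneg (hz2.1 x)]
        refine mul_le_mul_of_nonneg_left ((hD x _ (hmem t ht) _ hz1.1).trans_eq ?_) (hz2.1 x)
        have habs : ∀ j, |(z.1 + t • (Pi.single i 1 : Fin K → ℝ)) j - z.1 j| =
            if j = i then t else 0 := fun j => by
          by_cases h : j = i <;> simp [h, ht.le]
        simp only [habs, Finset.sum_ite_eq', Finset.mem_univ, reduceIte, mul_comm]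
    _ = t * M := by rw [← Finset.sum_mul, hz2.2, one_mul]

/-- The closure of the graph of `∇_p F`. -/
def gradGraph (D : (Fin K → ℝ) → X → ℝ) : Set (((Fin K → ℝ) × (X → ℝ)) × (Fin K → ℝ)) :=
  closure ((fun u => (u, gradP D u)) '' diffSet D)

theorem isCompact_gradGraph (hM : 0 ≤ M) (hD : LipschitzOnOrthant D M) :
    IsCompact (gradGraph D) := by
  refine (isCompact_stateSpace.prod (isCompact_closedBall (0 : Fin K → ℝ) M)).closure_of_subset ?_
  rintro _ ⟨u, hu, rfl⟩
  refine ⟨hu.1, mem_closedBall_zero_iff.2 ?_⟩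
  exact (pi_norm_le_iff_of_nonneg hM).2 fun i => abs_gradP_le hD hu i

theorem clarkeP_eq (z : (Fin K → ℝ) × (X → ℝ)) :
    clarkeP D z = convexHull ℝ {f | (z, f) ∈ gradGraph D} := by
  rw [clarkeP]
  congr 1
  ext f
  simp only [gradGraph, mem_ofPred_eq, mem_closure_iff_seq_limit]
  constructor
  · rintro ⟨u, hu, hz, hf⟩
    exact ⟨_, fun n => ⟨u n, hu n, rfl⟩, hz.prodMk_nhds hf⟩
  · rintro ⟨v, hv, hlim⟩
    choose u hu huv using hv
    obtain rfl : (fun n => (u n, gradP D (u n))) = v := funext huv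
    exact ⟨u, hu, (continuous_fst.tendsto _).comp hlim, (continuous_snd.tendsto _).comp hlim⟩

theorem isCompact_graph_clarkeP (hM : 0 ≤ M) (hD : LipschitzOnOrthant D M) :
    IsCompact {w : ((Fin K → ℝ) × (X → ℝ)) × (Fin K → ℝ) | w.2 ∈ clarkeP D w.1} := by
  simp only [clarkeP_eq]
  exact (isCompact_gradGraph hM hD).fiberwise_convexHull

/-- The triples `(z, f, q)` with `q` maximal for `f` form a compact set; project out `f`, then take
fibrewise hulls again. -/
theorem isCompact_graph_lmoP (hM : 0 ≤ M) (hD : LipschitzOnOrthant D M) :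
    IsCompact {w : ((Fin K → ℝ) × (X → ℝ)) × (Fin K → ℝ) | w.2 ∈ lmoP D w.1} := by
  have h1 : IsCompact {v : (((Fin K → ℝ) × (X → ℝ)) × (Fin K → ℝ)) × (Fin K → ℝ) |
      v ∈ {w : ((Fin K → ℝ) × (X → ℝ)) × (Fin K → ℝ) | w.2 ∈ clarkeP D w.1} ×ˢ
        stdSimplex ℝ (Fin K) ∧
      ∀ q' ∈ stdSimplex ℝ (Fin K), q' ⬝ᵥ v.1.2 ≤ v.2 ⬝ᵥ v.1.2} := by
    refine ((isCompact_graph_clarkeP hM hD).prod (isCompact_stdSimplex ℝ (Fin K))).inter_right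
      (t := {v : (((Fin K → ℝ) × (X → ℝ)) × (Fin K → ℝ)) × (Fin K → ℝ) |
        ∀ q' ∈ stdSimplex ℝ (Fin K), q' ⬝ᵥ v.1.2 ≤ v.2 ⬝ᵥ v.1.2}) ?_
    simp only [ofPred_forall]
    refine isClosed_iInter fun q' => isClosed_iInter fun _ => isClosed_le ?_ ?_
    · exact continuous_const.dotProduct (by fun_prop)
    · exact Continuous.dotProduct (by fun_prop) (by fun_prop)
  have h2 := (h1.image (f := fun v => (v.1.1, v.2)) (by fun_prop)).fiberwise_convexHull
  suffices hset : ∀ z : (Fin K → ℝ) × (X → ℝ), {q | q ∈ stdSimplex ℝ (Fin K) ∧ ∃ f ∈ clarkeP D z,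
      ∀ q' ∈ stdSimplex ℝ (Fin K), q' ⬝ᵥ f ≤ q ⬝ᵥ f} = {q | (z, q) ∈ (fun v => (v.1.1, v.2)) ''
      {v : (((Fin K → ℝ) × (X → ℝ)) × (Fin K → ℝ)) × (Fin K → ℝ) |
      v ∈ {w : ((Fin K → ℝ) × (X → ℝ)) × (Fin K → ℝ) | w.2 ∈ clarkeP D w.1} ×ˢ
        stdSimplex ℝ (Fin K) ∧
      ∀ q' ∈ stdSimplex ℝ (Fin K), q' ⬝ᵥ v.1.2 ≤ v.2 ⬝ᵥ v.1.2}} by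
    simpa only [lmoP, hset] using h2
  intro z
  ext q
  constructor
  · rintro ⟨hq, f, hf, hmax⟩
    exact ⟨((z, f), q), ⟨⟨hf, hq⟩, hmax⟩, rfl⟩
  · rintro ⟨⟨⟨z', f⟩, q'⟩, ⟨⟨hf, hq⟩, hmax⟩, h⟩
    obtain ⟨rfl, rfl⟩ := Prod.mk.inj h
    exact ⟨hq, f, hf, hmax⟩

theorem isCompact_graph_drift [DecidableEq X] (hM : 0 ≤ M) (hD : LipschitzOnOrthant D M) :
    IsCompact (graph (drift D)) := by
  let S : Set ((((Fin K → ℝ) × (X → ℝ)) × (Fin K → ℝ)) × (X → ℝ)) :=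
    ({w | w.2 ∈ lmoP D w.1} ∩ Prod.fst ⁻¹' stateSpace K X) ×ˢ stdSimplex ℝ X
  have hS : IsCompact S := ((isCompact_graph_lmoP hM hD).inter_right
    (isCompact_stateSpace.isClosed.preimage continuous_fst)).prod (isCompact_stdSimplex ℝ X)
  have hgrad : ContinuousOn
      (fun v : (((Fin K → ℝ) × (X → ℝ)) × (Fin K → ℝ)) × (X → ℝ) => gradMu D v.1.1) S := by
    refine continuousOn_pi.2 fun x => ?_
    simp only [gradMu_apply]
    exact (hD.continuousOn x).comp (f := fun v : (((Fin K → ℝ) × (X → ℝ)) × (Fin K → ℝ)) ×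
      (X → ℝ) => v.1.1.1) (by fun_prop) fun v hv => hv.1.2.1.1
  -- The constraints are closed relative to `S`, where `gradMu` is known to be continuous.
  have hT : IsCompact (S ∩ ⋂ ν' ∈ stdSimplex ℝ X,
      {v ∈ S | v.2 ⬝ᵥ gradMu D v.1.1 ≤ ν' ⬝ᵥ gradMu D v.1.1}) := by
    refine hS.inter_right (isClosed_iInter fun ν' => isClosed_iInter fun _ =>
      hS.isClosed.isClosed_le ?_ ?_)
    · exact continuousOn_finsetSum _ fun x _ =>
        ContinuousOn.mul (by fun_prop) (continuousOn_pi.1 hgrad x)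
    · exact continuousOn_finsetSum _ fun x _ =>
        continuousOn_const.mul (continuousOn_pi.1 hgrad x)
  convert hT.image (f := fun v => (v.1.1, (v.1.2 - v.1.1.1, v.2 - v.1.1.2))) (by fun_prop)
  ext ⟨z, y⟩
  constructor
  · rintro ⟨hz, q, hq, ν, hν, hy⟩
    have hmem : ((z, q), ν) ∈ S := ⟨⟨hq, hz⟩, hν.1⟩
    exact ⟨((z, q), ν), ⟨hmem, mem_iInter₂.2 fun ν' hν' => ⟨hmem, hν.2 ν' hν'⟩⟩,
      Prod.ext rfl hy.symm⟩
  · rintro ⟨⟨⟨z', q⟩, ν⟩, ⟨hv, hmin⟩, h⟩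
    obtain ⟨rfl, rfl⟩ := Prod.mk.inj h
    exact ⟨hv.1.2, q, hv.1.1, ν, ⟨hv.2, fun ν' hν' => (mem_iInter₂.1 hmin ν' hν').2⟩, rfl⟩

theorem isCompact_drift [DecidableEq X] (hG : IsCompact (graph (drift D)))
    {z : (Fin K → ℝ) × (X → ℝ)} (hz : z ∈ stateSpace K X) : IsCompact (drift D z) := by
  convert (hG.inter_right (isClosed_singleton.preimage (t := {z}) continuous_fst)).image
    continuous_snd
  ext y
  constructor
  · intro hy
    exact ⟨(z, y), ⟨⟨hz, hy⟩, rfl⟩, rfl⟩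
  · rintro ⟨⟨z', y'⟩, ⟨⟨-, hy⟩, rfl⟩, rfl⟩
    exact hy

theorem convex_drift [DecidableEq X] (z : (Fin K → ℝ) × (X → ℝ)) : Convex ℝ (drift D z) := by
  have hmu : Convex ℝ (lmoMu D z) := by
    rintro ν ⟨hν, hν'⟩ ρ ⟨hρ, hρ'⟩ a b ha hb hab
    refine ⟨convex_stdSimplex ℝ X hν hρ ha hb hab, fun σ hσ => ?_⟩
    have h1 := mul_le_mul_of_nonneg_left (hν' σ hσ) ha
    have h2 := mul_le_mul_of_nonneg_left (hρ' σ hσ) hb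
    rw [add_dotProduct, smul_dotProduct, smul_dotProduct, smul_eq_mul, smul_eq_mul]
    calc _ ≤ a * (σ ⬝ᵥ gradMu D z) + b * (σ ⬝ᵥ gradMu D z) := add_le_add h1 h2
      _ = σ ⬝ᵥ gradMu D z := by rw [← add_mul, hab, one_mul]
  have hP : Convex ℝ (lmoP D z) := convex_convexHull ℝ _
  suffices h : drift D z = (fun x => -z + x) '' (lmoP D z ×ˢ lmoMu D z) from
    h ▸ (hP.prod hmu).translate (-z)
  ext y
  constructor
  · rintro ⟨q, hq, ν, hν, rfl⟩
    exact ⟨(q, ν), ⟨hq, hν⟩, Prod.ext (by simp; abel) (by simp; abel)⟩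
  · rintro ⟨⟨q, ν⟩, ⟨hq, hν⟩, rfl⟩
    exact ⟨q, hq, ν, hν, Prod.ext (by simp; abel) (by simp; abel)⟩

/-! ### Perturbed drifts near the graph of the drift. -/

/-- The graph of `G^ε` lies within `ε` of the graph of `G`. -/
theorem exists_mem_graph_drift_of_mem_perturbedDrift [DecidableEq X]
    (hG : IsCompact (graph (drift D))) {ε : ℝ} (hε : 0 ≤ ε) {z y : (Fin K → ℝ) × (X → ℝ)}
    (hy : y ∈ perturbedDrift D ε z) :
    ∃ z' y', (z', y') ∈ graph (drift D) ∧ l1 (z - z') + l1 (y - y') ≤ ε := by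
  obtain ⟨z', hz', h⟩ := hy
  -- Over an empty fibre `l1Dist` is `∞`, which the bound `ε` excludes.
  obtain hemp | hne := (drift D z').eq_empty_or_nonempty
  · simp [l1Dist, hemp] at h
  obtain ⟨y', hy', hmin⟩ := (isCompact_drift hG hz').exists_isMinOn hne
    (f := fun a => l1 (y - a)) (continuous_l1.comp (by fun_prop)).continuousOn
  refine ⟨z', y', ⟨hz', hy'⟩, ?_⟩
  have hle : ENNReal.ofReal (l1 (y - y')) ≤ l1Dist y (drift D z') :=
    le_iInf₂ fun a ha => ENNReal.ofReal_le_ofReal (hmin ha)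
  have := (add_le_add_right hle (ENNReal.ofReal (l1 (z - z')))).trans h
  rwa [← ENNReal.ofReal_add (l1_nonneg _) (l1_nonneg _), ENNReal.ofReal_le_ofReal_iff hε] at this

theorem mem_perturbedDrift_zero_of_mem_drift [DecidableEq X] {z y : (Fin K → ℝ) × (X → ℝ)}
    (hz : z ∈ stateSpace K X) (hy : y ∈ drift D z) : y ∈ perturbedDrift D 0 z := by
  refine ⟨z, hz, ?_⟩
  have hle : l1Dist y (drift D z) ≤ ENNReal.ofReal (l1 (y - y)) := iInf₂_le y hy
  simpa [l1] using hle

/-- The perturbed drifts are jointly upper semicontinuous in the point and in the perturbation. -/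
theorem exists_perturbedDrift_subset_cthickening [DecidableEq X]
    (hG : IsCompact (graph (drift D))) (z : (Fin K → ℝ) × (X → ℝ)) {η : ℝ} (hη : 0 < η) :
    ∃ r > 0, ∀ ε, 0 ≤ ε → ε < r → ∀ u, dist u z < r →
      perturbedDrift D ε u ⊆ Metric.cthickening η (drift D z) := by
  by_contra! h
  choose ε hε hεr u hu hsub using fun n : ℕ => h (1 / ((n : ℝ) + 1)) (by positivity)
  simp only [not_subset] at hsub
  choose y hy hyn using hsub
  choose u' y' hmem hle using fun n =>
    exists_mem_graph_drift_of_mem_perturbedDrift hG (hε n) (hy n)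
  -- A limit of the nearby graph points lies over `z`, and the supposedly distant `y n` converge to
  -- it along `φ`.
  obtain ⟨⟨a, b⟩, hab, φ, hφ, hlim⟩ := hG.tendsto_subseq hmem
  have h0 : Tendsto (fun n => 1 / ((φ n : ℝ) + 1)) atTop (𝓝 0) :=
    tendsto_one_div_add_atTop_nhds_zero_nat.comp hφ.tendsto_atTop
  have hu' : Tendsto (fun n => u' (φ n)) atTop (𝓝 a) := (continuous_fst.tendsto _).comp hlim
  have hy' : Tendsto (fun n => y' (φ n)) atTop (𝓝 b) := (continuous_snd.tendsto _).comp hlim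
  have hdist : ∀ n, dist (u n) (u' n) ≤ 1 / ((n : ℝ) + 1) ∧
      dist (y n) (y' n) ≤ 1 / ((n : ℝ) + 1) := fun n => by
    rw [dist_eq_norm, dist_eq_norm]
    constructor <;> linarith [norm_le_l1 (u n - u' n), norm_le_l1 (y n - y' n),
      l1_nonneg (u n - u' n), l1_nonneg (y n - y' n), hle n, hεr n]
  have haz : a = z := by
    have h1 : Tendsto (fun n => u (φ n)) atTop (𝓝 z) := tendsto_iff_dist_tendsto_zero.2
      (squeeze_zero (fun _ => dist_nonneg) (fun n => (hu (φ n)).le) h0)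
    refine tendsto_nhds_unique hu' ((tendsto_iff_of_dist ?_).1 h1)
    exact squeeze_zero (fun _ => dist_nonneg) (fun n => (hdist (φ n)).1) h0
  subst haz
  have hyb : Tendsto (fun n => y (φ n)) atTop (𝓝 b) := (tendsto_iff_of_dist
    (squeeze_zero (fun _ => dist_nonneg) (fun n => (hdist (φ n)).2) h0)).2 hy'
  obtain ⟨n, hn⟩ := (hyb.eventually (Metric.closedBall_mem_nhds b hη)).exists
  exact hyn (φ n) (Metric.closedBall_subset_cthickening hab.2 η hn)

end SelfPlay

/-! ### Limits of solutions of the perturbed inclusions. -/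

namespace SelfPlay

variable {K : ℕ} {X : Type*} [Fintype X] [DecidableEq X] {D : (Fin K → ℝ) → X → ℝ}

/-- Mean slopes, unlike derivatives, pass to uniform limits; the inclusion is used only in this
form. -/
theorem slope_mem_of_mem_solutions {ε T : ℝ} {z₀ : (Fin K → ℝ) × (X → ℝ)}
    {z : ℝ → (Fin K → ℝ) × (X → ℝ)} (hz : z ∈ solutions D ε T z₀) {a b : ℝ} (ha : 0 ≤ a)
    (hab : a < b) (hb : b ≤ T) {C : Set ((Fin K → ℝ) × (X → ℝ))} (hC : Convex ℝ C)
    (hCc : IsClosed C) (hsub : ∀ t ∈ Icc a b, perturbedDrift D ε (z t) ⊆ C) :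
    (b - a)⁻¹ • (z b - z a) ∈ C := by
  obtain ⟨-, -, hac, hd⟩ := hz
  refine (hac.mono ?_).slope_mem_of_ae_hasDerivAt hab hC hCc ?_
  · rw [uIcc_of_le hab.le, uIcc_of_le (ha.trans (hab.le.trans hb))]
    exact Icc_subset_Icc ha hb
  · rw [ae_restrict_iff' measurableSet_Icc] at hd
    filter_upwards [hd] with t ht hmem
    obtain ⟨y, hy, hyd⟩ := ht ⟨ha.trans hmem.1.le, hmem.2.trans hb⟩
    exact ⟨y, hsub t ⟨hmem.1.le, hmem.2⟩ hy, hyd⟩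

theorem dist_le_of_mem_solutions {ε T L : ℝ} {z₀ : (Fin K → ℝ) × (X → ℝ)}
    {z : ℝ → (Fin K → ℝ) × (X → ℝ)} (hz : z ∈ solutions D ε T z₀)
    (hL : ∀ u, perturbedDrift D ε u ⊆ Metric.closedBall 0 L) {s t : ℝ} (hs : s ∈ Icc 0 T)
    (ht : t ∈ Icc 0 T) : dist (z s) (z t) ≤ L * dist s t := by
  wlog hst : s ≤ t generalizing s t
  · rw [dist_comm, dist_comm s t]
    exact this ht hs (le_of_not_ge hst)
  obtain rfl | hlt := hst.eq_or_lt
  · simp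
  have h := slope_mem_of_mem_solutions hz hs.1 hlt ht.2 (convex_closedBall 0 L)
    Metric.isClosed_closedBall fun u _ => hL (z u)
  have hpos : 0 < t - s := sub_pos.2 hlt
  rw [mem_closedBall_zero_iff, norm_smul, norm_inv, Real.norm_of_nonneg hpos.le,
    inv_mul_le_iff₀ hpos] at h
  rwa [dist_comm, dist_eq_norm, dist_comm, Real.dist_eq, abs_of_pos hpos, mul_comm]

/-- A differentiable limit of solutions of perturbed inclusions solves the limit inclusion. -/
theorem deriv_mem_drift_of_tendsto (hG : IsCompact (graph (drift D))) {T : ℝ} {ε : ℕ → ℝ}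
    {z₀ : ℕ → (Fin K → ℝ) × (X → ℝ)} {z : ℕ → ℝ → (Fin K → ℝ) × (X → ℝ)}
    {g : ℝ → (Fin K → ℝ) × (X → ℝ)} (hε0 : ∀ n, 0 ≤ ε n) (hε : Tendsto ε atTop (𝓝 0))
    (hz : ∀ n, z n ∈ solutions D (ε n) T (z₀ n)) (hzg : TendstoUniformlyOn z g atTop (Icc 0 T))
    {t : ℝ} (ht : t ∈ Ioo 0 T) (hgt : g t ∈ stateSpace K X) {y : (Fin K → ℝ) × (X → ℝ)}
    (hy : HasDerivAt g y t) : y ∈ drift D (g t) := by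
  rw [← (isCompact_drift hG hgt).isClosed.closure_eq, Metric.closure_eq_iInter_cthickening]
  refine mem_iInter₂.2 fun η hη => ?_
  obtain ⟨r, hr, hsub⟩ := exists_perturbedDrift_subset_cthickening hG (g t) hη
  obtain ⟨ρ, hρ, hgρ⟩ := Metric.continuousAt_iff.1 hy.continuousAt (r / 2) (by positivity)
  have hevent : ∀ᶠ n in atTop, ε n < r ∧ ∀ s ∈ Icc 0 T, dist (g s) (z n s) < r / 2 :=
    (hε.eventually (gt_mem_nhds hr)).and
      (Metric.tendstoUniformlyOn_iff.1 hzg (r / 2) (by positivity))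
  -- For large `n`, `z n` stays within `r` of `g t` on `[t, t + h]`, so its slope lies in the convex
  -- thickening, which is closed under `n → ∞`.
  have hslope : ∀ h : ℝ, 0 < h → h < ρ → t + h ≤ T →
      h⁻¹ • (g (t + h) - g t) ∈ Metric.cthickening η (drift D (g t)) := by
    intro h hh hhρ hhT
    have hlim : Tendsto (fun n => h⁻¹ • (z n (t + h) - z n t)) atTop
        (𝓝 (h⁻¹ • (g (t + h) - g t))) :=
      ((hzg.tendsto_at ⟨by linarith [ht.1], hhT⟩).sub
        (hzg.tendsto_at ⟨ht.1.le, ht.2.le⟩)).const_smul _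
    refine Metric.isClosed_cthickening.mem_of_tendsto hlim ?_
    filter_upwards [hevent] with n hn
    have := slope_mem_of_mem_solutions (hz n) ht.1.le (b := t + h) (by linarith) hhT
      ((convex_drift (D := D) (g t)).cthickening η) Metric.isClosed_cthickening fun s hs => by
        refine hsub (ε n) (hε0 n) hn.1 (z n s) ?_
        have h1 := hn.2 s ⟨ht.1.le.trans hs.1, hs.2.trans hhT⟩
        have h2 : dist (g s) (g t) < r / 2 := hgρ (by
          rw [Real.dist_eq, abs_of_nonneg (by linarith [hs.1])]
          linarith [hs.2])
        rw [dist_comm] at h1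
        linarith [dist_triangle (z n s) (g s) (g t)]
    simpa using this
  refine Metric.isClosed_cthickening.mem_of_tendsto hy.tendsto_slope_zero_right ?_
  have hm : 0 < min ρ (T - t) := lt_min hρ (sub_pos.2 ht.2)
  filter_upwards [Ioo_mem_nhdsGT hm] with h hh
  exact hslope h hh.1 (hh.2.trans_le (min_le_left _ _))
    (by linarith [hh.2.trans_le (min_le_right _ _)])

/-- Along perturbations that tend to zero, solutions have a subsequence that converges uniformly to
a solution of the unperturbed inclusion. -/
theorem exists_subseq_tendstoUniformlyOn_solution (hG : IsCompact (graph (drift D))) {T : ℝ}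
    (hT : 0 < T) {ε : ℕ → ℝ} {z₀ : ℕ → (Fin K → ℝ) × (X → ℝ)}
    {z : ℕ → ℝ → (Fin K → ℝ) × (X → ℝ)} (hε0 : ∀ n, 0 ≤ ε n) (hε1 : ∀ n, ε n ≤ 1)
    (hε : Tendsto ε atTop (𝓝 0)) (hz : ∀ n, z n ∈ solutions D (ε n) T (z₀ n)) :
    ∃ (φ : ℕ → ℕ) (g : ℝ → (Fin K → ℝ) × (X → ℝ)), StrictMono φ ∧ g 0 ∈ stateSpace K X ∧
      g ∈ solutions D 0 T (g 0) ∧ TendstoUniformlyOn (fun n => z (φ n)) g atTop (Icc 0 T) := by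
  obtain ⟨R, hR⟩ := hG.isBounded.exists_norm_le
  have hL : ∀ n u, perturbedDrift D (ε n) u ⊆ Metric.closedBall 0 (|R| + 1) := by
    intro n u y hy
    obtain ⟨u', y', hmem, hle⟩ := exists_mem_graph_drift_of_mem_perturbedDrift hG (hε0 n) hy
    have h1 := (norm_snd_le (u', y')).trans (hR _ hmem)
    have h2 := norm_le_l1 (y - y')
    have h3 := norm_le_norm_add_norm_sub' y y'
    rw [mem_closedBall_zero_iff]
    linarith [l1_nonneg (u - u'), hε1 n, le_abs_self R]
  have hL0 : 0 ≤ |R| + 1 := by positivity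
  set L : NNReal := ⟨|R| + 1, hL0⟩
  have hlip : ∀ n, LipschitzWith L fun s : Icc (0 : ℝ) T => z n s := fun n =>
    LipschitzWith.of_dist_le_mul fun s t => dist_le_of_mem_solutions (hz n) (hL n) s.2 t.2
  let A : Set (BoundedContinuousFunction (Icc (0 : ℝ) T) ((Fin K → ℝ) × (X → ℝ))) :=
    {f | LipschitzWith L f ∧ ∀ s, f s ∈ stateSpace K X}
  have hA : IsCompact A := by
    refine BoundedContinuousFunction.arzela_ascoli₂ (stateSpace K X) isCompact_stateSpace A ?_
      (fun f s hf => hf.2 s) ?_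
    · have hA' : A = (⋂ s, ⋂ t, {f | dist (f s) (f t) ≤ L * dist s t}) ∩
          ⋂ s, {f | f s ∈ stateSpace K X} := by
        ext f
        simp only [A, lipschitzWith_iff_dist_le_mul, mem_ofPred_eq, mem_inter_iff, mem_iInter]
      rw [hA']
      refine (isClosed_iInter fun s => isClosed_iInter fun t => isClosed_le ?_ ?_).inter
        (isClosed_iInter fun s => isCompact_stateSpace.isClosed.preimage ?_)
      · exact (continuous_eval_const s).dist (continuous_eval_const t)
      · exact continuous_const
      · exact continuous_eval_const s
    · exact (LipschitzWith.uniformEquicontinuous _ L fun f => f.2.1).equicontinuous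
  let F : ℕ → BoundedContinuousFunction (Icc (0 : ℝ) T) ((Fin K → ℝ) × (X → ℝ)) := fun n =>
    BoundedContinuousFunction.mkOfCompact ⟨fun s => z n s, (hlip n).continuous⟩
  obtain ⟨f, hf, φ, hφ, hlim⟩ := hA.tendsto_subseq (x := F) fun n =>
    ⟨hlip n, fun s => (hz n).2.1 s s.2⟩
  -- Constant extension keeps `g` Lipschitz on all of `ℝ`, so it is differentiable almost
  -- everywhere.
  let g : ℝ → (Fin K → ℝ) × (X → ℝ) := IccExtend hT.le f
  have hgS : ∀ t, g t ∈ stateSpace K X := fun t => hf.2 _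
  have hgL : LipschitzWith L g := by
    simpa [g, IccExtend] using hf.1.comp (LipschitzWith.projIcc hT.le)
  have hgz : TendstoUniformlyOn (fun n => z (φ n)) g atTop (Icc 0 T) := by
    have hu := BoundedContinuousFunction.tendsto_iff_tendstoUniformly.1 hlim
    rw [Metric.tendstoUniformly_iff] at hu
    rw [Metric.tendstoUniformlyOn_iff]
    intro e he
    filter_upwards [hu e he] with n hn s hs
    have : g s = f ⟨s, hs⟩ := IccExtend_of_mem hT.le f hs
    rw [this]
    exact hn ⟨s, hs⟩
  refine ⟨φ, g, hφ, hgS 0, ⟨rfl, fun t _ => hgS t,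
    (hgL.lipschitzOnWith).absolutelyContinuousOnInterval, ?_⟩, hgz⟩
  rw [← restrict_Ioo_eq_restrict_Icc, ae_restrict_iff' measurableSet_Ioo]
  filter_upwards [hgL.ae_differentiableAt_real] with t hd ht
  exact ⟨deriv g t, mem_perturbedDrift_zero_of_mem_drift (hgS t)
    (deriv_mem_drift_of_tendsto hG (fun n => hε0 (φ n)) (hε.comp hφ.tendsto_atTop)
      (fun n => hz (φ n)) hgz ht (hgS t) hd.hasDerivAt), hd.hasDerivAt⟩

theorem exists_solution_close_of_perturbed_solution (hG : IsCompact (graph (drift D))) {δ T : ℝ}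
    (hδ : 0 < δ) (hT : 0 < T) :
    ∃ ε : ℝ, 0 < ε ∧ ∀ w ∈ graph (solutions D ε T), ∃ w' ∈ graph (solutions D 0 T),
      ∀ t ∈ Icc 0 T, l1 (w.1 - w'.1) + l1 (w.2 t - w'.2 t) ≤ δ := by
  by_contra! h
  choose w hw hfar using fun n : ℕ => h (1 / ((n : ℝ) + 1)) (by positivity)
  obtain ⟨φ, g, -, hg0, hg, hlim⟩ := exists_subseq_tendstoUniformlyOn_solution hG hT
    (fun n => by positivity) (fun n => by
      rw [div_le_one (by positivity)]
      linarith [(Nat.cast_nonneg n : (0 : ℝ) ≤ n)])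
    tendsto_one_div_add_atTop_nhds_zero_nat fun n => (hw n).2
  set C : ℝ := K + Fintype.card X
  have hC : 0 ≤ C := by positivity
  -- The `ℓ¹` norm is at most `C` times the sup norm; `C + 1` avoids division by zero. Half of `δ`
  -- serves the paths, half the starting points (time `0`).
  obtain ⟨n, hn⟩ := (Metric.tendstoUniformlyOn_iff.1 hlim (δ / (2 * (C + 1)))
    (by positivity)).exists
  have hclose : ∀ t ∈ Icc 0 T, l1 ((w (φ n)).2 t - g t) ≤ δ / 2 := fun t ht => by
    have h1 := hn t ht
    rw [dist_comm, dist_eq_norm, lt_div_iff₀ (by positivity)] at h1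
    have h2 := l1_le_norm ((w (φ n)).2 t - g t)
    linarith [norm_nonneg ((w (φ n)).2 t - g t)]
  obtain ⟨t, ht, hlt⟩ := hfar (φ n) (g 0, g) ⟨hg0, hg⟩
  have h0 := hclose 0 ⟨le_rfl, hT.le⟩
  rw [(hw (φ n)).2.1] at h0
  linarith [hclose t ht]

end SelfPlay

/-! ### The proposition. -/

open SelfPlay in
theorem proposition3 {K d : ℕ} {Ans : Type*} {X : Type*} [Fintype X] [DecidableEq X]
    (B : BanditModel K d Ans) (θ : EuclideanSpace ℝ (Fin d)) (hθ : θ ∈ B.states)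
    (A : B.AltDecomposition θ X)
    (hgrad : BoundedGradients (B.scenarioPayoff θ A))
    (hsmooth : SmoothInside (B.scenarioPayoff θ A)) :
    (∀ ε : ℝ, 0 < ε →
      ∀ w ∈ graph (perturbedDrift (B.scenarioPayoff θ A) ε),
        ∃ w' ∈ graph (drift (B.scenarioPayoff θ A)),
          l1 (w.1 - w'.1) + l1 (w.2 - w'.2) ≤ ε) ∧
    (∀ δ T : ℝ, 0 < δ → 0 < T → ∃ ε : ℝ, 0 < ε ∧
      ∀ w ∈ graph (solutions (B.scenarioPayoff θ A) ε T),
        ∃ w' ∈ graph (solutions (B.scenarioPayoff θ A) 0 T),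
          ∀ t ∈ Set.Icc 0 T, l1 (w.1 - w'.1) + l1 (w.2 t - w'.2 t) ≤ δ) := by
  obtain ⟨M, hM, hD⟩ := BanditModel.exists_lipschitz_scenarioPayoff A hgrad hsmooth
  have hG := isCompact_graph_drift hM hD
  refine ⟨fun ε hε w hw => ?_, fun δ T hδ hT =>
    exists_solution_close_of_perturbed_solution hG hδ hT⟩
  obtain ⟨z', y', hmem, hle⟩ := exists_mem_graph_drift_of_mem_perturbedDrift hG hε.le hw.2
  exact ⟨(z', y'), hmem, hle⟩
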